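/- Let $d\ge 1$ and let $\mathcal X\subset\mathbb R^d$ be closed, convex and bounded, with Euclidean diameter $D$. Let $f:\mathcal X\to\mathbb R$ be $G$-Lipschitz, $L$-smooth (differentiable with $L$-Lipschitz gradient on $\mathcal X$) and $\mu$-strongly convex on $\mathcal X$ with $\mu>0$. Let $x_0\in\mathcal X$ and let $\mathcal X\supseteq S_1\supseteq S_2\supseteq\dots\supseteq S_T$ be nonempty closed convex sets, $T\ge 1$. For $1\le t\le T$ write $v_t=\min_{x\in S_t}f(x)$, and let $\Pi_K$ denote Euclidean projection onto $K$. The algorithm FRUGAL starts with $F_0=0$ and, at each time $t=1,\dots,T$, after $S_t$ is revealed, computes the lazy action $\hat x_t=\Pi_{S_t}(x_{t-1})$ and the nearest minimizer $x^\star_{\mathrm{near},t}=\Pi_{\arg\min_{S_t} f}(x_{t-1})$, plays $$x_t=\begin{cases}\hat x_t & \text{if } F_{t-1}+f(\hat x_t)\le t\,v_t,\\ x^\star_{\mathrm{near},t} & \text{otherwise,}\end{cases}$$ and sets $F_t=F_{t-1}+f(x_t)$. Then $x_t\in S_t$ for all $1\le t\le T$, and FRUGAL has non-positive regret at all times: on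 every such instance, $$\sum_{\tau=1}^{t}f(x_\tau)-t\,\min_{x\in S_t}f(x)\le 0\qquad\text{for all }1\le t\le T.$$ Moreover, there is an absolute constant $C>0$ (independent of $d,\mathcal X,f,G,L,\mu,T,x_0$ and the sets $S_t$) such that, whenever $T\ge 2$, the movement cost satisfies $$\sum_{t=1}^{T}\|x_t-x_{t-1}\|\le C\,d^{d/2}\,\frac{2G+(L+\mu)D}{\mu}\,\log T .$$ -/

import Mathlib

noncomputable section

namespace CONES

/-- The Euclidean space `ℝ^d` with the `2`-norm. -/
abbrev E (d : ℕ) : Type := EuclideanSpace ℝ (Fin d)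

open Classical in
/-- The Euclidean projection of `x` onto `K`: a point of `K` nearest to `x`. For a nonempty closed
convex set `K` such a point exists and is unique; if there is no nearest point, the value is `x`. -/
def proj {d : ℕ} (K : Set (E d)) (x : E d) : E d :=
  if h : ∃ p ∈ K, ∀ q ∈ K, ‖x - p‖ ≤ ‖x - q‖ then h.choose else x

/-- The set of minimizers of `f` over `K`. -/
def minimizers {d : ℕ} (f : E d → ℝ) (K : Set (E d)) : Set (E d) :=
  {x | x ∈ K ∧ ∀ y ∈ K, f x ≤ f y}

/-- The minimum value of `f` over `K` (attained for the sets and functions considered here). -/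
def minValue {d : ℕ} (f : E d → ℝ) (K : Set (E d)) : ℝ :=
  sInf (f '' K)

/-- The state `(x_t, F_t)` of FRUGAL after round `t`: the current action and the loss accumulated
so far. In round `t + 1` the set `S (t + 1)` is revealed; the lazy action is the projection of the
current action onto it, and it is played exactly when the accumulated loss stays at most `t + 1`
times the minimum of `f` over the revealed set; otherwise the nearest minimizer is played. -/
def frugalState {d : ℕ} (f : E d → ℝ) (S : ℕ → Set (E d)) (x₀ : E d) : ℕ → E d × ℝ
  | 0 => (x₀, 0)
  | t + 1 =>
    let x := (frugalState f S x₀ t).1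
    let F := (frugalState f S x₀ t).2
    let lazyAction := proj (S (t + 1)) x
    let nearestMin := proj (minimizers f (S (t + 1))) x
    let next :=
      if F + f lazyAction ≤ ((t + 1 : ℕ) : ℝ) * minValue f (S (t + 1)) then lazyAction
      else nearestMin
    (next, F + f next)

/-- The action `x_t` of FRUGAL at time `t`; at time `0` it is the fixed initial action. -/
def frugal {d : ℕ} (f : E d → ℝ) (S : ℕ → Set (E d)) (x₀ : E d) (t : ℕ) : E d :=
  (frugalState f S x₀ t).1

/-- The total loss `∑_{t=1}^T f(x_t)` of an action sequence. -/
def lossCost {d : ℕ} (f : E d → ℝ) (x : ℕ → E d) (T : ℕ) : ℝ :=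
  ∑ t ∈ Finset.Icc 1 T, f (x t)

/-- The total movement cost `∑_{t=1}^T ‖x_t - x_{t-1}‖` of an action sequence. -/
def movementCost {d : ℕ} (x : ℕ → E d) (T : ℕ) : ℝ :=
  ∑ t ∈ Finset.Icc 1 T, ‖x t - x (t - 1)‖

/-- The loss of the static optimal benchmark with horizon `T`, which plays a minimizer of `f` over
`S T` in every round. -/
def optCost {d : ℕ} (f : E d → ℝ) (S : ℕ → Set (E d)) (T : ℕ) : ℝ :=
  (T : ℝ) * minValue f (S T)

/-- The regret of an action sequence at time `T` on the instance `(f, S)`. -/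
def regret {d : ℕ} (f : E d → ℝ) (S : ℕ → Set (E d)) (x : ℕ → E d) (T : ℕ) : ℝ :=
  lossCost f x T - optCost f S T

/-- An admissible constraint sequence with horizon `T`: the sets `S 1 ⊇ S 2 ⊇ ⋯ ⊇ S T` are
nonempty closed convex subsets of `X`. -/
structure IsNested {d : ℕ} (X : Set (E d)) (S : ℕ → Set (E d)) (T : ℕ) : Prop where
  nonempty : ∀ t, 1 ≤ t → t ≤ T → (S t).Nonempty
  isClosed : ∀ t, 1 ≤ t → t ≤ T → IsClosed (S t)
  convex : ∀ t, 1 ≤ t → t ≤ T → Convex ℝ (S t)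
  subset : S 1 ⊆ X
  anti : ∀ t, 1 ≤ t → t + 1 ≤ T → S (t + 1) ⊆ S t

/-- `f` is `L`-smooth on `X`: it is differentiable on `X` (relative to `X`, since `f` matters only
on `X`) with an `L`-Lipschitz gradient. -/
def SmoothOn {d : ℕ} (f : E d → ℝ) (L : NNReal) (X : Set (E d)) : Prop :=
  ∃ g : E d → E d, (∀ x ∈ X, HasGradientWithinAt f (g x) X x) ∧ LipschitzOnWith L g X

end CONES

end

/-! Regret: a lazy action passes the test `F + f ≤ t * v_t` by construction. A jump costs exactly
`v_t`, and since `v_t` is nondecreasing, the bound from the previous round survives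
(`lossCost_frugal_le`).

Movement: cut time at the jumps. Between jumps the path consists of successive projections onto
nested convex sets. Such a path is self-contracted, so its length is at most a dimensional constant
times the distance from its start to any point of the last set (`sum_norm_sub_le_of_inner_nonpos`).
To see this, run the path backwards and integrate over a ball the support function of the points
seen so far. Each new point raises the integral by at least its step length times the volume of a
dual cone cap, which fills a fraction `4 ^ (-d)` of the unit ball, while the integral stays bounded.

It remains to sum the distances `R` between consecutive jumps at `s < t`. In between, all actions
stay within `R` of `x_t`, so their losses exceed `v_t` by at most `G * R`. The jump at `t` then
forces `s * (v_t - v_s) ≤ (t - s) * G * R`, while quadratic growth gives `v_t - v_s ≥ μ / 4 * R ^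
2`. Hence `R ≤ (4 * G / μ) * (t - s) / s` (`norm_sub_le_of_isJump`). Together with `R ≤ D` this is
`O(log (t / s))`, which telescopes to `log T`. -/

open MeasureTheory Set
open scoped RealInnerProductSpace Pointwise

namespace CONES

/-! ### Dual cones of acute families and the length of self-contracted paths. -/

section Geometry

variable {V : Type*} [NormedAddCommGroup V] [InnerProductSpace ℝ V]

/-- The points of the closed unit ball lying in the dual cone of `W`. -/
def dualCap (W : Set V) : Set V :=
  {w | ∀ v ∈ W, 0 ≤ ⟪v, w⟫} ∩ Metric.closedBall 0 1

theorem convex_dualCap (W : Set V) : Convex ℝ (dualCap W) := by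
  refine Convex.inter ?_ (convex_closedBall 0 1)
  intro x hx y hy a b ha hb _ v hv
  rw [inner_add_right, inner_smul_right, inner_smul_right]
  have := hx v hv
  have := hy v hv
  positivity

theorem continuous_partialSups_inner (z : ℕ → V) (k : ℕ) :
    Continuous fun ξ : V => partialSups (fun i => ⟪z i, ξ⟫) k := by
  induction k with
  | zero => simpa using by fun_prop
  | succ k ih =>
    simp only [partialSups_add_one]
    exact ih.sup (by fun_prop)

variable [FiniteDimensional ℝ V]

theorem isCompact_dualCap (W : Set V) : IsCompact (dualCap W) := by
  refine (isCompact_closedBall (0 : V) 1).inter_left ?_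
  simp only [ofPred_forall]
  exact isClosed_biInter fun v _ => isClosed_le continuous_const (by fun_prop)

/-- Moreau's decomposition for the dual cone of a set of vectors with pairwise acute angles. -/
theorem closedBall_subset_dualCap_sub {W : Set V} (hW : ∀ v ∈ W, ∀ w ∈ W, 0 ≤ ⟪v, w⟫) :
    Metric.closedBall 0 1 ⊆ dualCap W - dualCap W := by
  intro x hx
  set D : Set V := {w | ∀ v ∈ W, 0 ≤ ⟪v, w⟫} with hD
  have hD0 : (0 : V) ∈ D := fun v _ => by simp
  have hDadd : ∀ a ∈ D, ∀ b ∈ D, a + b ∈ D := fun a ha b hb v hv => by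
    rw [inner_add_right]
    exact add_nonneg (ha v hv) (hb v hv)
  have hDconv : Convex ℝ D := by
    intro x hx y hy a b ha hb _ v hv
    rw [inner_add_right, inner_smul_right, inner_smul_right]
    have := hx v hv
    have := hy v hv
    positivity
  have hDclosed : IsClosed D := by
    simp only [hD, ofPred_forall]
    exact isClosed_biInter fun v _ => isClosed_le continuous_const (by fun_prop)
  -- Write `x = (x + p) - p` with `p` the projection of `-x` onto the dual cone `D`. Then `x + p`
  -- pairs nonnegatively with all of `D`, which contains `W` by acuteness, so `x + p` lies in `D`
  -- too.
  obtain ⟨p, hp, hpmin⟩ :=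
    exists_norm_eq_iInf_of_complete_convex ⟨0, hD0⟩ hDclosed.isComplete hDconv (-x)
  rw [norm_eq_iInf_iff_real_inner_le_zero hDconv hp] at hpmin
  have h0 : ⟪-x - p, p⟫ = 0 := by
    have h1 := hpmin 0 hD0
    have h2 := hpmin (p + p) (hDadd p hp p hp)
    simp only [zero_sub, inner_neg_right, add_sub_cancel_right] at h1 h2
    linarith
  have hq : x + p ∈ D := by
    intro v hv
    have h1 := hpmin (v + p) (hDadd v (fun w hw => hW w hw v hv) p hp)
    rw [add_sub_cancel_right, real_inner_comm] at h1
    have h2 : x + p = -(-x - p) := by abel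
    rw [h2, inner_neg_right]
    linarith
  have hx1 : ‖x‖ ≤ 1 := by simpa using hx
  have hnorm : ‖x‖ * ‖x‖ = ‖-x - p‖ * ‖-x - p‖ + ‖p‖ * ‖p‖ := by
    rw [← norm_add_sq_eq_norm_sq_add_norm_sq_real h0, sub_add_cancel, norm_neg]
  have hnorm' : ‖-x - p‖ = ‖x + p‖ := by rw [← norm_neg]; congr 1; abel
  rw [hnorm'] at hnorm
  refine ⟨x + p, ⟨hq, ?_⟩, p, ⟨hp, ?_⟩, by simp⟩
  · rw [mem_closedBall_zero_iff]
    nlinarith [norm_nonneg x, norm_nonneg (x + p), norm_nonneg p]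
  · rw [mem_closedBall_zero_iff]
    nlinarith [norm_nonneg x, norm_nonneg (x + p), norm_nonneg p]

variable [MeasurableSpace V] [BorelSpace V]

/-- A Rogers–Shephard type inequality: a set covered by the differences of a compact convex set of
positive volume `vol K` has volume at most `4 ^ dim * vol K`. -/
theorem volume_le_of_subset_sub {K B : Set V} (hK : Convex ℝ K) (hKc : IsCompact K)
    (hK0 : volume K ≠ 0) (hB : MeasurableSet B) (hBK : B ⊆ K - K) :
    volume B ≤ 4 ^ Module.finrank ℝ V * volume K := by
  set n := Module.finrank ℝ V
  set A : Set V := (2 : ℝ) • K with hA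
  have hAm : MeasurableSet A := (hKc.smul 2).isClosed.measurableSet
  have hadd : ∀ x ∈ K, ∀ y ∈ K, x + y ∈ A := by
    intro x hx y hy
    refine ⟨(1 / 2 : ℝ) • x + (1 / 2 : ℝ) • y, hK hx hy (by norm_num) (by norm_num)
      (by norm_num), ?_⟩
    simp only [smul_add, smul_smul]
    norm_num
  have hvolA : volume A = 2 ^ n * volume K := by
    rw [hA, Measure.addHaar_smul]
    congr 1
    rw [abs_of_nonneg (by positivity), ENNReal.ofReal_pow (by norm_num)]
    norm_num [n]
  -- For `x = a - c` with `a, c ∈ K`, the translate `K + a` lies in both `A = 2K` and `A + x`, so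
  -- these overlap in volume at least `vol K`. Integrating the overlap over all `x` gives `vol A ^
  -- 2`.
  have key : volume B * volume K ≤ volume A * volume A := by
    calc volume B * volume K = ∫⁻ _ in B, volume K := by rw [setLIntegral_const, mul_comm]
      _ ≤ ∫⁻ x in B, ∫⁻ p, A.indicator 1 p * A.indicator 1 (p - x) := by
          refine setLIntegral_mono' hB fun x hx => ?_
          obtain ⟨a, ha, c, hc, rfl⟩ := hBK hx
          calc volume K = volume ((fun y => y + a) '' K) := by
                rw [image_add_right, measure_preimage_add_right]
            _ = ∫⁻ p, ((fun y => y + a) '' K).indicator 1 p := by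
                rw [lintegral_indicator_one]
                exact (hKc.image (by fun_prop)).isClosed.measurableSet
            _ ≤ ∫⁻ p, A.indicator 1 p * A.indicator 1 (p - (a - c)) := by
                refine lintegral_mono fun p => ?_
                refine indicator_le
                  (g := fun p => (A.indicator 1 p * A.indicator 1 (p - (a - c)) : ENNReal))
                  (fun q hq => ?_) p
                obtain ⟨y, hy, rfl⟩ := hq
                have h1 : y + a ∈ A := hadd y hy a ha
                have h2 : y + a - (a - c) ∈ A := by
                  have := hadd y hy c hc
                  convert this using 1
                  abel
                simp [h1, h2]
      _ ≤ ∫⁻ x, ∫⁻ p, A.indicator 1 p * A.indicator 1 (p - x) := setLIntegral_le_lintegral _ _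
      _ = ∫⁻ p, ∫⁻ x, A.indicator 1 p * A.indicator 1 (p - x) := by
          refine lintegral_lintegral_swap (Measurable.aemeasurable ?_)
          have h1 : Measurable (A.indicator (1 : V → ENNReal)) := measurable_one.indicator hAm
          exact (h1.comp measurable_snd).mul (h1.comp (measurable_snd.sub measurable_fst))
      _ = ∫⁻ p, A.indicator 1 p * volume A := by
          refine lintegral_congr fun p => ?_
          have h1 : Measurable (A.indicator (1 : V → ENNReal)) := measurable_one.indicator hAm
          have h2 : Measurable fun x : V => A.indicator (1 : V → ENNReal) (p - x) :=
            h1.comp (measurable_const.sub measurable_id)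
          rw [lintegral_const_mul _ h2,
            lintegral_sub_left_eq_self (fun x => A.indicator (1 : V → ENNReal) x) p,
            lintegral_indicator_one hAm]
      _ = volume A * volume A := by
          rw [lintegral_mul_const _ (measurable_one.indicator hAm), lintegral_indicator_one hAm]
  have hfin : volume K ≠ ⊤ := hKc.measure_lt_top.ne
  rw [hvolA] at key
  have h4 : (2 : ENNReal) ^ n * volume K * (2 ^ n * volume K)
      = 4 ^ n * volume K * volume K := by
    rw [show (4 : ENNReal) = 2 * 2 by norm_num, mul_pow]
    ring
  rw [h4] at key
  exact (ENNReal.mul_le_mul_iff_left hK0 hfin).1 key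

/-- The dual cone of a finite acute family fills a fraction `4 ^ (-dim)` of the unit ball. -/
theorem volume_closedBall_le_dualCap {ι : Type*} [Finite ι] {v : ι → V}
    (hv : ∀ i j, 0 ≤ ⟪v i, v j⟫) {u : V} (hu : ∀ i, 0 < ⟪v i, u⟫) :
    volume.real (Metric.closedBall (0 : V) 1) ≤
      4 ^ Module.finrank ℝ V * volume.real (dualCap (range v)) := by
  have hcap := isCompact_dualCap (range v)
  have hpos : volume (dualCap (range v)) ≠ 0 := by
    -- The vector `u`, scaled into the ball, witnesses that the cap has interior, hence positive
    -- volume.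
    set O : Set V := {w | ∀ i, 0 < ⟪v i, w⟫} ∩ Metric.ball 0 1 with hO
    have hOopen : IsOpen O := by
      refine IsOpen.inter ?_ Metric.isOpen_ball
      simp only [ofPred_forall]
      exact isOpen_iInter_of_finite fun i => isOpen_lt continuous_const (by fun_prop)
    have hOne : O.Nonempty := by
      refine ⟨(1 / (1 + ‖u‖)) • u, fun i => ?_, ?_⟩
      · rw [inner_smul_right]
        have := hu i
        positivity
      · rw [mem_ball_zero_iff, norm_smul, Real.norm_of_nonneg (by positivity),
          one_div_mul_eq_div, div_lt_one (by positivity)]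
        linarith
    have hsub : O ⊆ dualCap (range v) := by
      rintro w ⟨h1, h2⟩
      refine ⟨?_, Metric.ball_subset_closedBall h2⟩
      rintro _ ⟨i, rfl⟩
      exact (h1 i).le
    exact ((hOopen.measure_pos volume hOne).trans_le (measure_mono hsub)).ne'
  have hle := volume_le_of_subset_sub (convex_dualCap (range v)) hcap hpos
    Metric.isClosed_closedBall.measurableSet (closedBall_subset_dualCap_sub (W := range v) (by
      rintro _ ⟨i, rfl⟩ _ ⟨j, rfl⟩
      exact hv i j))
  have h := ENNReal.toReal_mono (ENNReal.mul_ne_top (by simp) hcap.measure_lt_top.ne) hle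
  simpa [Measure.real, ENNReal.toReal_mul] using h

/-- The length of a discrete self-contracted path, written in reverse order, is bounded in terms of
the dimension and the radius of a ball containing it. -/
theorem sum_norm_sub_le_of_acute {z : ℕ → V} {n : ℕ} {R : ℝ} (hR : ∀ k ≤ n, ‖z k‖ ≤ R)
    (hacute : ∀ k < n, ∀ i ≤ k, ∀ j ≤ k, 0 ≤ ⟪z i - z (k + 1), z j - z (k + 1)⟫)
    (hsupp : ∀ k < n, ∀ i ≤ k,
      ‖z k - z (k + 1)‖ ^ 2 ≤ ⟪z i - z (k + 1), z k - z (k + 1)⟫) :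
    ∑ k ∈ Finset.range n, ‖z k - z (k + 1)‖ ≤ 4 * 8 ^ Module.finrank ℝ V * R := by
  set d := Module.finrank ℝ V
  -- `H k` is the support function of the hull of `z 0, …, z k`; its integral over `B` plays the
  -- role of mean width.
  set H : ℕ → V → ℝ := fun k ξ => partialSups (fun i => ⟪z i, ξ⟫) k with hH
  set B : Set V := Metric.closedBall 0 2 with hB
  set b : ℝ := volume.real (Metric.closedBall (0 : V) 1) with hb
  have hBc : IsCompact B := isCompact_closedBall _ _
  have hbpos : 0 < b := by
    refine ENNReal.toReal_pos ?_ (isCompact_closedBall (0 : V) 1).measure_lt_top.ne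
    exact (Metric.measure_closedBall_pos volume 0 one_pos).ne'
  have hBvol : volume.real B = 2 ^ d * b := by
    have h := Measure.addHaar_closedBall_mul_of_pos volume (0 : V) (r := 2) two_pos 1
    rw [mul_one] at h
    rw [hB, hb, Measure.real, h, ENNReal.toReal_mul, ENNReal.toReal_ofReal (by positivity)]
    rfl
  have hint : ∀ k, IntegrableOn (H k) B := fun k =>
    (continuous_partialSups_inner z k).continuousOn.integrableOn_compact hBc
  have hmono : ∀ k ξ, H k ξ ≤ H (k + 1) ξ := fun k ξ =>
    (partialSups (fun i => ⟪z i, ξ⟫)).monotone k.le_succ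
  have hstep : ∀ k < n,
      ‖z k - z (k + 1)‖ * b ≤ 4 ^ d * ((∫ ξ in B, H (k + 1) ξ) - ∫ ξ in B, H k ξ) := by
    intro k hk
    set δ := ‖z k - z (k + 1)‖ with hδ
    rw [← integral_sub (hint (k + 1)) (hint k)]
    have hnn : ∀ ξ, 0 ≤ H (k + 1) ξ - H k ξ := fun ξ => sub_nonneg.2 (hmono k ξ)
    rcases (norm_nonneg (z k - z (k + 1))).eq_or_lt with h0 | hpos
    · rw [hδ, ← h0, zero_mul]
      exact mul_nonneg (by positivity) (integral_nonneg hnn)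
    rw [← hδ] at hpos
    set u : V := δ⁻¹ • (z k - z (k + 1)) with hu
    have hunorm : ‖u‖ = 1 := by
      rw [hu, norm_smul, norm_inv, Real.norm_of_nonneg hpos.le, ← hδ, inv_mul_cancel₀ hpos.ne']
    set v : Fin (k + 1) → V := fun i => z i - z (k + 1) with hv
    have hvu : ∀ i, δ ≤ ⟪v i, u⟫ := by
      intro i
      have := hsupp k hk i (Nat.lt_succ_iff.1 i.2)
      rw [hu, inner_smul_right, inv_mul_eq_div, le_div_iff₀ hpos, ← sq]
      exact this
    have hcap := volume_closedBall_le_dualCap (v := v)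
      (fun i j => hacute k hk i (Nat.lt_succ_iff.1 i.2) j (Nat.lt_succ_iff.1 j.2))
      (fun i => hpos.trans_le (hvu i))
    set K := dualCap (range v)
    have hKc : IsCompact K := isCompact_dualCap _
    -- The cap reflected and shifted by the unit vector `-u`, which is why `B` has radius `2`. For
    -- `ξ ∈ Q`, `⟪v i, ξ⟫ ≤ -⟪v i, u⟫ ≤ -δ`, so the new point beats every old one by `δ` in
    -- direction `ξ`.
    set Q : Set V := (fun ξ => -u - ξ) ⁻¹' K with hQ
    have hQm : MeasurableSet Q := by
      exact (hKc.isClosed.preimage (by fun_prop)).measurableSet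
    have hQvol : volume.real Q = volume.real K := by
      rw [Measure.real, Measure.real, hQ,
        (Measure.measurePreserving_sub_left volume (-u)).measure_preimage
          hKc.isClosed.measurableSet.nullMeasurableSet]
    have hQB : Q ⊆ B := by
      rintro ξ ⟨-, h2⟩
      rw [mem_closedBall_zero_iff] at h2
      rw [hB, mem_closedBall_zero_iff]
      calc ‖ξ‖ = ‖-u - (-u - ξ)‖ := by congr 1; abel
        _ ≤ ‖-u‖ + ‖-u - ξ‖ := norm_sub_le _ _
        _ ≤ 2 := by rw [norm_neg, hunorm]; linarith
    have hgap : ∀ ξ ∈ Q, δ ≤ H (k + 1) ξ - H k ξ := by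
      rintro ξ ⟨h1, -⟩
      have hle : H k ξ ≤ ⟪z (k + 1), ξ⟫ - δ := by
        refine partialSups_le _ _ _ fun i hi => ?_
        have h2 := h1 _ ⟨⟨i, Nat.lt_succ_iff.2 hi⟩, rfl⟩
        have h3 := hvu ⟨i, Nat.lt_succ_iff.2 hi⟩
        simp only [hv, inner_sub_left, inner_sub_right, inner_neg_right] at h2 h3
        linarith
      have hge : ⟪z (k + 1), ξ⟫ ≤ H (k + 1) ξ :=
        le_partialSups (fun i => ⟪z i, ξ⟫) (k + 1)
      linarith
    have hintd : IntegrableOn (fun ξ => H (k + 1) ξ - H k ξ) B := (hint (k + 1)).sub (hint k)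
    have hQfin : volume Q ≠ ⊤ := ((measure_mono hQB).trans_lt hBc.measure_lt_top).ne
    have hlow : δ * volume.real Q ≤ ∫ ξ in B, (H (k + 1) ξ - H k ξ) := by
      refine (setIntegral_ge_of_const_le_real hQm hQfin hgap (hintd.mono_set hQB)).trans ?_
      exact setIntegral_mono_set hintd (.of_forall hnn) hQB.eventuallyLE
    calc δ * b ≤ δ * (4 ^ d * volume.real K) := by gcongr
      _ = 4 ^ d * (δ * volume.real Q) := by rw [hQvol]; ring
      _ ≤ _ := by gcongr
  have hbound : ∀ k ≤ n, |∫ ξ in B, H k ξ| ≤ 2 * R * (2 ^ d * b) := by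
    intro k hk
    rw [← hBvol, ← Real.norm_eq_abs]
    refine norm_setIntegral_le_of_norm_le_const hBc.measure_lt_top fun ξ hξ => ?_
    rw [hB, mem_closedBall_zero_iff] at hξ
    have hin : ∀ i ≤ k, |⟪z i, ξ⟫| ≤ 2 * R := fun i hi => by
      have h1 := abs_real_inner_le_norm (z i) ξ
      have h2 := hR i (hi.trans hk)
      nlinarith [norm_nonneg (z i), norm_nonneg ξ]
    rw [Real.norm_eq_abs, abs_le]
    constructor
    · exact (abs_le.1 (hin k le_rfl)).1.trans (le_partialSups (fun i => ⟪z i, ξ⟫) k)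
    · exact partialSups_le _ _ _ fun i hi => (abs_le.1 (hin i hi)).2
  have hsum : (∑ k ∈ Finset.range n, ‖z k - z (k + 1)‖) * b ≤
      4 ^ d * ((∫ ξ in B, H n ξ) - ∫ ξ in B, H 0 ξ) := by
    rw [← Finset.sum_range_sub (fun k => ∫ ξ in B, H k ξ), Finset.sum_mul, Finset.mul_sum]
    exact Finset.sum_le_sum fun k hk => hstep k (Finset.mem_range.1 hk)
  have h1 := (abs_le.1 (hbound n le_rfl)).2
  have h2 := (abs_le.1 (hbound 0 n.zero_le)).1
  refine le_of_mul_le_mul_right ?_ hbpos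
  calc _ ≤ 4 ^ d * ((∫ ξ in B, H n ξ) - ∫ ξ in B, H 0 ξ) := hsum
    _ ≤ 4 ^ d * (4 * R * (2 ^ d * b)) := by gcongr; linarith
    _ = 4 * 8 ^ d * R * b := by
      rw [show (8 : ℝ) = 4 * 2 by norm_num, mul_pow]; ring

end Geometry

end CONES

namespace CONES

/-! ### Successive projections onto nested convex sets. -/

section Path

variable {V : Type*} [NormedAddCommGroup V] [InnerProductSpace ℝ V]

theorem norm_sub_le_of_inner_nonpos {x y q : V} (h : ⟪x - y, q - y⟫ ≤ 0) : ‖y - q‖ ≤ ‖x - q‖ := by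
  have h1 : x - q = (x - y) - (q - y) := by abel
  have h2 := norm_sub_sq_real (x - y) (q - y)
  rw [← h1] at h2
  rw [norm_sub_rev y q]
  refine le_of_sq_le_sq ?_ (norm_nonneg _)
  nlinarith [sq_nonneg ‖x - y‖]

theorem inner_sub_nonneg_of_norm_le {p a b : V} (h : ‖a - b‖ ≤ ‖p - b‖) :
    0 ≤ ⟪a - p, b - p⟫ := by
  have h1 : a - b = (a - p) - (b - p) := by abel
  have h2 := norm_sub_sq_real (a - p) (b - p)
  rw [← h1, norm_sub_rev b p] at h2
  nlinarith [sq_nonneg ‖a - p‖, norm_nonneg (a - b), norm_nonneg (p - b)]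

/-- Successive projections do not increase the distance to a point of all sets projected on. -/
theorem norm_sub_le_of_forall_inner_nonpos {x : ℕ → V} {q : V} {a b : ℕ} (hab : a ≤ b)
    (h : ∀ i, a ≤ i → i < b → ⟪x i - x (i + 1), q - x (i + 1)⟫ ≤ 0) :
    ‖x b - q‖ ≤ ‖x a - q‖ := by
  induction b, hab using Nat.le_induction with
  | base => rfl
  | succ b hab ih =>
    exact (norm_sub_le_of_inner_nonpos (h b hab b.lt_succ_self)).trans
      (ih fun i h1 h2 => h i h1 (h2.trans b.lt_succ_self))

variable [FiniteDimensional ℝ V] [MeasurableSpace V] [BorelSpace V]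

/-- The length of a path of successive projections onto nested convex sets is bounded by a
dimensional constant times the distance of its starting point to any point of the last set. -/
theorem sum_norm_sub_le_of_inner_nonpos {x : ℕ → V} {y : V} {n : ℕ}
    (hx : ∀ i j, i < j → j ≤ n → ⟪x i - x (i + 1), x j - x (i + 1)⟫ ≤ 0)
    (hy : ∀ i < n, ⟪x i - x (i + 1), y - x (i + 1)⟫ ≤ 0) :
    ∑ i ∈ Finset.range n, ‖x (i + 1) - x i‖ ≤ 4 * 8 ^ Module.finrank ℝ V * ‖x 0 - y‖ := by
  -- Time is reversed because acuteness is seen from an earlier point looking at later ones: later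
  -- points lie in all earlier sets, so the path only approaches them. Centring at `y` gives the
  -- radius.
  have key := sum_norm_sub_le_of_acute (z := fun k => x (n - k) - y) (n := n) (R := ‖x 0 - y‖)
    (fun k _ => norm_sub_le_of_forall_inner_nonpos (Nat.zero_le _)
      fun i _ hi => hy i (hi.trans_le (Nat.sub_le _ _))) ?_ ?_
  · rw [← Finset.sum_range_reflect]
    refine le_trans (le_of_eq (Finset.sum_congr rfl fun k hk => ?_)) key
    have hk' := Finset.mem_range.1 hk
    rw [sub_sub_sub_cancel_right, show n - 1 - k = n - (k + 1) by omega,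
      show n - (k + 1) + 1 = n - k by omega]
  · intro k hk i hi j hj
    simp only [sub_sub_sub_cancel_right]
    have main : ∀ a b, n - (k + 1) ≤ a → a ≤ b → b ≤ n →
        0 ≤ ⟪x a - x (n - (k + 1)), x b - x (n - (k + 1))⟫ := by
      intro a b h1 h2 h3
      refine inner_sub_nonneg_of_norm_le (norm_sub_le_of_forall_inner_nonpos h1 ?_)
      intro l _ hl
      exact hx l b (hl.trans_le h2) h3
    rcases le_total i j with hij | hij
    · rw [real_inner_comm]
      exact main _ _ (by omega) (by omega) (by omega)
    · exact main _ _ (by omega) (by omega) (by omega)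
  · intro k hk i hi
    simp only [sub_sub_sub_cancel_right]
    obtain ⟨m, hm⟩ : ∃ m, m = n - (k + 1) := ⟨_, rfl⟩
    rw [← hm, show n - k = m + 1 by omega]
    have h := hx m (n - i) (by omega) (by omega)
    have h1 : x (n - i) - x m = (x (n - i) - x (m + 1)) + (x (m + 1) - x m) := by abel
    have h2 : x (m + 1) - x m = -(x m - x (m + 1)) := by abel
    rw [h1, inner_add_left, real_inner_self_eq_norm_sq, h2, inner_neg_right, real_inner_comm]
    linarith

end Path

/-! ### Projections, minimizers and quadratic growth. -/

section Projection

variable {d : ℕ} {K : Set (E d)}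

theorem proj_spec (hK : IsClosed K) (hne : K.Nonempty) (x : E d) :
    proj K x ∈ K ∧ ∀ q ∈ K, ‖x - proj K x‖ ≤ ‖x - q‖ := by
  have h : ∃ p ∈ K, ∀ q ∈ K, ‖x - p‖ ≤ ‖x - q‖ := by
    obtain ⟨p, hp, hpx⟩ := hK.exists_infDist_eq_dist hne x
    refine ⟨p, hp, fun q hq => ?_⟩
    rw [← dist_eq_norm, ← dist_eq_norm, ← hpx]
    exact Metric.infDist_le_dist_of_mem hq
  rw [proj, dif_pos h]
  exact h.choose_spec

theorem inner_sub_proj_nonpos (hK : IsClosed K) (hc : Convex ℝ K) (x : E d) {q : E d}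
    (hq : q ∈ K) : ⟪x - proj K x, q - proj K x⟫ ≤ 0 := by
  obtain ⟨hp, hmin⟩ := proj_spec hK ⟨q, hq⟩ x
  refine (norm_eq_iInf_iff_real_inner_le_zero hc hp).1 ?_ q hq
  have : Nonempty K := ⟨⟨q, hq⟩⟩
  refine le_antisymm (le_ciInf fun w => hmin w w.2) (ciInf_le ⟨0, ?_⟩ (⟨_, hp⟩ : K))
  rintro _ ⟨w, rfl⟩
  exact norm_nonneg _

end Projection

section Minimizers

variable {d : ℕ} {X K : Set (E d)} {f : E d → ℝ} {μ : ℝ}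

theorem minValue_eq_of_mem_minimizers {m : E d} (hm : m ∈ minimizers f K) :
    minValue f K = f m :=
  IsLeast.csInf_eq ⟨mem_image_of_mem f hm.1, forall_mem_image.2 hm.2⟩

/-- Quadratic growth of a strongly convex function away from its minimizer. -/
theorem sq_norm_sub_le_of_mem_minimizers (hf : StrongConvexOn X μ f) (hK : Convex ℝ K)
    (hKX : K ⊆ X) {m y : E d} (hm : m ∈ minimizers f K) (hy : y ∈ K) :
    μ / 4 * ‖m - y‖ ^ 2 ≤ f y - f m := by
  obtain ⟨-, hf⟩ := hf
  -- Comparing `m` with the midpoint of `m` and `y` is enough; this yields `μ / 4` instead of the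
  -- sharp `μ / 2`.
  have h1 := hf (hKX hm.1) (hKX hy) (a := 1 / 2) (b := 1 / 2) (by norm_num) (by norm_num)
    (by norm_num)
  have h2 := hm.2 _ (hK hm.1 hy (a := 1 / 2) (b := 1 / 2) (by norm_num) (by norm_num)
    (by norm_num))
  simp only [smul_eq_mul] at h1
  linarith

theorem proj_minimizers_mem (hf : StrongConvexOn X μ f) (hμ : 0 < μ) (hcont : ContinuousOn f X)
    (hX : Bornology.IsBounded X) (hKc : IsClosed K) (hK : Convex ℝ K) (hKX : K ⊆ X)
    (hne : K.Nonempty) (x : E d) : proj (minimizers f K) x ∈ minimizers f K := by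
  obtain ⟨m, hmK, hm⟩ := (Metric.isCompact_of_isClosed_isBounded hKc
    (hX.subset hKX)).exists_isMinOn hne (hcont.mono hKX)
  have hm' : m ∈ minimizers f K := ⟨hmK, fun y hy => hm hy⟩
  -- Quadratic growth makes the minimizer unique, so the projection is onto a singleton and never
  -- takes its default value.
  have hsing : minimizers f K = {m} := by
    refine eq_singleton_iff_unique_mem.2 ⟨hm', fun y hy => ?_⟩
    have h1 := sq_norm_sub_le_of_mem_minimizers hf hK hKX hm' hy.1
    have h2 := hy.2 m hmK
    have h3 : ‖m - y‖ ^ 2 ≤ 0 := by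
      by_contra! h
      have := mul_pos (div_pos hμ four_pos) h
      linarith
    have h4 : ‖m - y‖ = 0 := by nlinarith [norm_nonneg (m - y)]
    exact (sub_eq_zero.1 (norm_eq_zero.1 h4)).symm
  rw [hsing]
  exact (proj_spec isClosed_singleton (singleton_nonempty m) x).1

end Minimizers

end CONES

namespace CONES

/-! ### Cost bookkeeping and the two branches of the algorithm. -/

section Costs

variable {d : ℕ} {f : E d → ℝ} {x : ℕ → E d}

theorem lossCost_succ (t : ℕ) : lossCost f x (t + 1) = lossCost f x t + f (x (t + 1)) :=
  Finset.sum_Icc_succ_top (by omega) _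

theorem movementCost_succ (t : ℕ) :
    movementCost x (t + 1) = movementCost x t + ‖x (t + 1) - x t‖ :=
  Finset.sum_Icc_succ_top (by omega) _

theorem lossCost_le_add_mul {s t : ℕ} {c : ℝ} (hst : s ≤ t)
    (h : ∀ τ, s < τ → τ ≤ t → f (x τ) ≤ c) :
    lossCost f x t ≤ lossCost f x s + ((t : ℝ) - s) * c := by
  induction t, hst using Nat.le_induction with
  | base => simp
  | succ t hst ih =>
    have h1 := ih fun τ h1 h2 => h τ h1 (h2.trans t.le_succ)
    have h2 := h (t + 1) (by omega) le_rfl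
    rw [lossCost_succ]
    push_cast
    linarith

theorem movementCost_add_sub (s n : ℕ) :
    movementCost x (s + n) - movementCost x s =
      ∑ i ∈ Finset.range n, ‖x (s + (i + 1)) - x (s + i)‖ := by
  induction n with
  | zero => simp
  | succ n ih =>
    rw [Finset.sum_range_succ, ← ih, ← add_assoc, movementCost_succ]
    ring

end Costs

section Frugal

variable {d : ℕ} {f : E d → ℝ} {S : ℕ → Set (E d)} {x₀ : E d}

/-- FRUGAL plays the nearest minimizer, rather than the lazy action, at time `t`. -/
def IsJump (f : E d → ℝ) (S : ℕ → Set (E d)) (x : ℕ → E d) (t : ℕ) : Prop :=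
  (t : ℝ) * minValue f (S t) < lossCost f x (t - 1) + f (proj (S t) (x (t - 1)))

theorem frugalState_snd (t : ℕ) :
    (frugalState f S x₀ t).2 = lossCost f (frugal f S x₀) t := by
  induction t with
  | zero => simp [frugalState, lossCost]
  | succ t ih => rw [lossCost_succ, ← ih]; rfl

theorem frugal_succ_of_not_isJump {t : ℕ} (h : ¬ IsJump f S (frugal f S x₀) (t + 1)) :
    frugal f S x₀ (t + 1) = proj (S (t + 1)) (frugal f S x₀ t) := by
  rw [IsJump, not_lt, Nat.add_sub_cancel, ← frugalState_snd] at h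
  exact if_pos h

theorem frugal_succ_of_isJump {t : ℕ} (h : IsJump f S (frugal f S x₀) (t + 1)) :
    frugal f S x₀ (t + 1) = proj (minimizers f (S (t + 1))) (frugal f S x₀ t) := by
  rw [IsJump, ← not_le, Nat.add_sub_cancel, ← frugalState_snd] at h
  exact if_neg h

end Frugal

theorem exists_last_or_forall_not (P : ℕ → Prop) (n : ℕ) :
    (∀ t, 1 ≤ t → t ≤ n → ¬ P t) ∨
      ∃ s, 1 ≤ s ∧ s ≤ n ∧ P s ∧ ∀ t, s < t → t ≤ n → ¬ P t := by
  induction n with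
  | zero => exact .inl fun t h1 h2 => by omega
  | succ n ih =>
    by_cases hP : P (n + 1)
    · exact .inr ⟨n + 1, by omega, le_rfl, hP, fun t h1 h2 => by omega⟩
    · have hext : ∀ t, t ≤ n + 1 → (t ≤ n → ¬ P t) → ¬ P t := fun t ht h => by
        rcases ht.eq_or_lt with rfl | h'
        · exact hP
        · exact h (Nat.lt_succ_iff.1 h')
      rcases ih with h | ⟨s, h1, h2, h3, h4⟩
      · exact .inl fun t ht ht' => hext t ht' (h t ht)
      · exact .inr ⟨s, h1, h2.trans n.le_succ, h3, fun t ht ht' => hext t ht' (h4 t ht)⟩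

/-- Both cases use `1 - s / t ≤ log (t / s)`. If `t ≤ 2 * s`, then `(t - s) / s ≤ 2 * (1 - s / t)`
and the bound with `A` suffices; otherwise the logarithm is at least `1 / 2` and absorbs `D`. -/
theorem le_mul_log_div {R D A s t : ℝ} (hs : 0 < s) (hst : s ≤ t) (hA : 0 ≤ A) (hD : 0 ≤ D)
    (h1 : R ≤ D) (h2 : R ≤ A * ((t - s) / s)) : R ≤ (2 * A + 2 * D) * Real.log (t / s) := by
  have ht : 0 < t := hs.trans_le hst
  have hlog := Real.one_sub_inv_le_log_of_pos (div_pos ht hs)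
  rw [inv_div] at hlog
  have hlog0 : 0 ≤ Real.log (t / s) := Real.log_nonneg ((one_le_div hs).2 hst)
  rcases le_total t (2 * s) with h | h
  · have h3 : (t - s) / s ≤ 2 * (1 - s / t) := by
      rw [one_sub_div ht.ne', ← mul_div_assoc, div_le_div_iff₀ hs ht]
      nlinarith
    nlinarith [mul_le_mul_of_nonneg_left (h3.trans (mul_le_mul_of_nonneg_left hlog zero_le_two)) hA,
      mul_nonneg hD hlog0]
  · have h3 : s / t ≤ 1 / 2 := by
      rw [div_le_iff₀ ht]
      linarith
    nlinarith [mul_nonneg hA hlog0,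
      mul_le_mul_of_nonneg_left (show 1 / 2 ≤ Real.log (t / s) by linarith) hD]

/-! ### Feasibility, regret and movement of FRUGAL. -/

section Bounds

variable {d : ℕ} {X : Set (E d)} {f : E d → ℝ} {G : NNReal} {μ : ℝ} {S : ℕ → Set (E d)} {T : ℕ}
  {x₀ : E d}

theorem IsNested.subset_of_le (hS : IsNested X S T) {s t : ℕ} (hs : 1 ≤ s) (hst : s ≤ t)
    (ht : t ≤ T) : S t ⊆ S s := by
  induction t, hst using Nat.le_induction with
  | base => exact subset_rfl
  | succ t hst ih => exact (hS.anti t (hs.trans hst) ht).trans (ih (by omega))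

theorem IsNested.subset_base (hS : IsNested X S T) {t : ℕ} (h1 : 1 ≤ t) (h2 : t ≤ T) : S t ⊆ X :=
  (hS.subset_of_le le_rfl h1 h2).trans hS.subset

theorem frugal_mem_minimizers (hX : Bornology.IsBounded X) (hG : LipschitzOnWith G f X)
    (hμ : 0 < μ) (hf : StrongConvexOn X μ f) (hS : IsNested X S T) {t : ℕ} (h1 : 1 ≤ t)
    (h2 : t ≤ T) (h : IsJump f S (frugal f S x₀) t) :
    frugal f S x₀ t ∈ minimizers f (S t) := by
  obtain ⟨t, rfl⟩ := Nat.exists_eq_add_of_le' h1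
  rw [frugal_succ_of_isJump h]
  exact proj_minimizers_mem hf hμ hG.continuousOn hX (hS.isClosed _ h1 h2) (hS.convex _ h1 h2)
    (hS.subset_base h1 h2) (hS.nonempty _ h1 h2) _

theorem frugal_mem (hX : Bornology.IsBounded X) (hG : LipschitzOnWith G f X)
    (hμ : 0 < μ) (hf : StrongConvexOn X μ f) (hS : IsNested X S T) {t : ℕ} (h1 : 1 ≤ t)
    (h2 : t ≤ T) : frugal f S x₀ t ∈ S t := by
  by_cases h : IsJump f S (frugal f S x₀) t
  · exact (frugal_mem_minimizers hX hG hμ hf hS h1 h2 h).1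
  · obtain ⟨t, rfl⟩ := Nat.exists_eq_add_of_le' h1
    rw [frugal_succ_of_not_isJump h]
    exact (proj_spec (hS.isClosed _ h1 h2) (hS.nonempty _ h1 h2) _).1

theorem minValue_mono (hX : Bornology.IsBounded X) (hG : LipschitzOnWith G f X)
    (hμ : 0 < μ) (hf : StrongConvexOn X μ f) (hS : IsNested X S T) {s t : ℕ} (hs : 1 ≤ s)
    (hst : s ≤ t) (ht : t ≤ T) : minValue f (S s) ≤ minValue f (S t) := by
  have hmin : ∀ r, 1 ≤ r → r ≤ T → ∃ m, m ∈ minimizers f (S r) := fun r h1 h2 =>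
    ⟨_, proj_minimizers_mem hf hμ hG.continuousOn hX (hS.isClosed _ h1 h2) (hS.convex _ h1 h2)
      (hS.subset_base h1 h2) (hS.nonempty _ h1 h2) 0⟩
  obtain ⟨a, ha⟩ := hmin s hs (hst.trans ht)
  obtain ⟨b, hb⟩ := hmin t (hs.trans hst) ht
  rw [minValue_eq_of_mem_minimizers ha, minValue_eq_of_mem_minimizers hb]
  exact ha.2 b (hS.subset_of_le hs hst ht hb.1)

/-- At a jump, `F_t + v_{t+1} ≤ t * v_t + v_{t+1} ≤ (t + 1) * v_{t+1}`; at a lazy step the claim is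
the test itself. -/
theorem lossCost_frugal_le (hX : Bornology.IsBounded X) (hG : LipschitzOnWith G f X)
    (hμ : 0 < μ) (hf : StrongConvexOn X μ f) (hS : IsNested X S T) {t : ℕ} (h2 : t ≤ T) :
    lossCost f (frugal f S x₀) t ≤ t * minValue f (S t) := by
  induction t with
  | zero => simp [lossCost]
  | succ t ih =>
    by_cases h : IsJump f S (frugal f S x₀) (t + 1)
    · have hm := frugal_mem_minimizers hX hG hμ hf hS (by omega) h2 h
      have h3 := ih (by omega)
      have h4 : (t : ℝ) * minValue f (S t) ≤ t * minValue f (S (t + 1)) := by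
        rcases Nat.eq_zero_or_pos t with rfl | ht
        · simp
        · exact mul_le_mul_of_nonneg_left (minValue_mono hX hG hμ hf hS ht t.le_succ h2)
            t.cast_nonneg
      rw [lossCost_succ, ← minValue_eq_of_mem_minimizers hm]
      push_cast
      linarith
    · have h3 := h
      rw [IsJump, not_lt, Nat.add_sub_cancel, ← frugal_succ_of_not_isJump h] at h3
      rwa [lossCost_succ]

/-- Between two jumps the movement cost is at most a dimensional constant times the distance of the
initial action to any point that stays feasible, and this distance does not increase. -/
theorem movementCost_sub_le_of_forall_not_isJump (hX : Bornology.IsBounded X)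
    (hG : LipschitzOnWith G f X) (hμ : 0 < μ) (hf : StrongConvexOn X μ f) (hS : IsNested X S T)
    {s t : ℕ} (hst : s ≤ t) (ht : t ≤ T)
    (hlazy : ∀ τ, s < τ → τ ≤ t → ¬ IsJump f S (frugal f S x₀) τ) {y : E d}
    (hy : ∀ τ, s < τ → τ ≤ t → y ∈ S τ) :
    movementCost (frugal f S x₀) t - movementCost (frugal f S x₀) s ≤
        4 * 8 ^ d * ‖frugal f S x₀ s - y‖ ∧
      ∀ τ, s ≤ τ → τ ≤ t → ‖frugal f S x₀ τ - y‖ ≤ ‖frugal f S x₀ s - y‖ := by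
  set x := frugal f S x₀ with hx
  have hstep : ∀ τ, s ≤ τ → τ < t → ∀ q ∈ S (τ + 1), ⟪x τ - x (τ + 1), q - x (τ + 1)⟫ ≤ 0 := by
    intro τ h1 h2 q hq
    rw [hx, frugal_succ_of_not_isJump (hlazy (τ + 1) (by omega) h2)]
    exact inner_sub_proj_nonpos (hS.isClosed _ (by omega) (by omega))
      (hS.convex _ (by omega) (by omega)) _ hq
  refine ⟨?_, fun τ h1 h2 => norm_sub_le_of_forall_inner_nonpos h1 fun i h3 h4 =>
    hstep i h3 (by omega) y (hy _ (by omega) (by omega))⟩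
  obtain ⟨n, rfl⟩ := Nat.exists_eq_add_of_le hst
  rw [movementCost_add_sub]
  have h := sum_norm_sub_le_of_inner_nonpos (x := fun i => x (s + i)) (y := y) (n := n)
    (fun i j hij hj => hstep (s + i) (by omega) (by omega) _
      (hS.subset_of_le (by omega) (show s + i + 1 ≤ s + j by omega) (by omega)
        (frugal_mem hX hG hμ hf hS (by omega) (by omega))))
    (fun i hi => hstep (s + i) (by omega) (by omega) _ (hy _ (by omega) (by omega)))
  simpa using h

/-- Two consecutive jumps at times `s < t` are at distance at most `(4 * G / μ) * (t - s) / s`. -/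
theorem norm_sub_le_of_isJump (hX : Bornology.IsBounded X) (hG : LipschitzOnWith G f X)
    (hμ : 0 < μ) (hf : StrongConvexOn X μ f) (hS : IsNested X S T) {s t : ℕ} (hs : 1 ≤ s)
    (hst : s < t) (ht : t ≤ T) (hjs : IsJump f S (frugal f S x₀) s)
    (hjt : IsJump f S (frugal f S x₀) t)
    (hlazy : ∀ τ, s < τ → τ ≤ t - 1 → ¬ IsJump f S (frugal f S x₀) τ) :
    ‖frugal f S x₀ s - frugal f S x₀ t‖ ≤ 4 * G / μ * (((t : ℝ) - s) / s) := by
  have hms := frugal_mem_minimizers hX hG hμ hf hS hs (by omega) hjs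
  have hmt := frugal_mem_minimizers hX hG hμ hf hS (by omega) ht hjt
  have hF := lossCost_frugal_le (x₀ := x₀) hX hG hμ hf hS (show s ≤ T by omega)
  have hmem : ∀ τ, 1 ≤ τ → τ ≤ T → frugal f S x₀ τ ∈ S τ := fun τ h1 h2 =>
    frugal_mem hX hG hμ hf hS h1 h2
  have hcon := (movementCost_sub_le_of_forall_not_isJump hX hG hμ hf hS
    (show s ≤ t - 1 by omega) (by omega) hlazy (y := frugal f S x₀ t)
    fun τ h1 h2 => hS.subset_of_le (by omega) (by omega) ht hmt.1).2
  rw [IsJump] at hjt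
  set x := frugal f S x₀ with hx
  set R := ‖x s - x t‖ with hR
  have hvs := minValue_eq_of_mem_minimizers hms
  have hvt := minValue_eq_of_mem_minimizers hmt
  rw [hvs] at hF
  rw [hvt] at hjt
  have hlip : ∀ p ∈ X, ‖p - x t‖ ≤ R → f p ≤ f (x t) + G * R := by
    intro p hp hpR
    have h1 := hG.dist_le_mul p hp (x t) (hS.subset_base (by omega) ht hmt.1)
    rw [Real.dist_eq, dist_eq_norm] at h1
    have h2 := mul_le_mul_of_nonneg_left hpR G.coe_nonneg
    linarith [le_abs_self (f p - f (x t))]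
  have hsum := lossCost_le_add_mul (f := f) (x := x) (c := f (x t) + G * R)
    (show s ≤ t - 1 by omega) fun τ h1 h2 =>
      hlip _ (hS.subset_base (by omega) (by omega) (hmem τ (by omega) (by omega)))
        (hcon τ h1.le h2)
  have hlast : f (proj (S t) (x (t - 1))) ≤ f (x t) + G * R := by
    refine hlip _ (hS.subset_base (by omega) ht (proj_spec (hS.isClosed _ (by omega) ht)
      (hS.nonempty _ (by omega) ht) _).1) ?_
    exact (norm_sub_le_of_inner_nonpos (inner_sub_proj_nonpos (hS.isClosed _ (by omega) ht)
      (hS.convex _ (by omega) ht) _ hmt.1)).trans (hcon (t - 1) (by omega) le_rfl)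
  have hquad := sq_norm_sub_le_of_mem_minimizers hf (hS.convex s hs (by omega))
    (hS.subset_base hs (by omega)) hms (hS.subset_of_le hs hst.le ht hmt.1)
  rw [← hR] at hquad
  have hs0 : (0 : ℝ) < s := by exact_mod_cast hs
  have hst' : (s : ℝ) < t := by exact_mod_cast hst
  rw [Nat.cast_sub (by omega), Nat.cast_one] at hsum
  -- The `t - 1 - s` rounds between the jumps and the rejected lazy action at `t` each contribute at
  -- most `G * R` above `v_t`.
  have hmain : (s : ℝ) * (μ / 4 * R ^ 2) ≤ (t - s) * (G * R) := by
    have := mul_le_mul_of_nonneg_left hquad hs0.le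
    linarith
  rcases (norm_nonneg (x s - x t)).eq_or_lt with h0 | hpos
  · rw [hR, ← h0]
    exact mul_nonneg (by positivity) (div_nonneg (by linarith) hs0.le)
  · rw [← hR] at hpos
    rw [div_mul_div_comm, le_div_iff₀ (by positivity)]
    refine le_of_mul_le_mul_right ?_ hpos
    linarith

theorem movementCost_frugal_le (hX : Bornology.IsBounded X) (hG : LipschitzOnWith G f X)
    (hμ : 0 < μ) (hf : StrongConvexOn X μ f) (hS : IsNested X S T) (hx₀ : x₀ ∈ X) (hT : 2 ≤ T) :
    movementCost (frugal f S x₀) T ≤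
      (4 * 8 ^ d + 1) * (8 * G / μ + 6 * Metric.diam X) * Real.log T := by
  set x := frugal f S x₀ with hx
  set D := Metric.diam X with hD
  set P : ℝ := 4 * 8 ^ d with hP
  have hP0 : 0 ≤ P := by positivity
  have hD0 : 0 ≤ D := Metric.diam_nonneg
  have hxX : ∀ t ≤ T, x t ∈ X := by
    intro t ht
    rcases Nat.eq_zero_or_pos t with rfl | h
    · exact hx₀
    · exact hS.subset_base h ht (frugal_mem hX hG hμ hf hS h ht)
  have hdist : ∀ s ≤ T, ∀ t ≤ T, ‖x s - x t‖ ≤ D := fun s hs t ht => by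
    rw [← dist_eq_norm]
    exact Metric.dist_le_diam_of_mem hX (hxX s hs) (hxX t ht)
  -- `P` pays for the lazy stretch up to `t - 1`, and the extra `1` for the last step into `x t`,
  -- whether a jump or not.
  have hmove : ∀ s t, s < t → t ≤ T → (∀ τ, s < τ → τ ≤ t - 1 → ¬ IsJump f S x τ) →
      movementCost x t ≤ movementCost x s + (P + 1) * ‖x s - x t‖ := by
    intro s t hst ht hlazy
    obtain ⟨h1, h2⟩ := movementCost_sub_le_of_forall_not_isJump hX hG hμ hf hS
      (show s ≤ t - 1 by omega) (by omega) hlazy (y := x t)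
      fun τ h1 h2 => hS.subset_of_le (by omega) (by omega) ht
        (frugal_mem hX hG hμ hf hS (by omega) ht)
    have h3 := h2 (t - 1) (by omega) le_rfl
    have h4 := movementCost_succ (x := x) (t - 1)
    rw [show t - 1 + 1 = t by omega, norm_sub_rev] at h4
    rw [← hx] at h1 h3
    linarith
  set A := 2 * (4 * G / μ) + 2 * D with hA
  have hA0 : 0 ≤ A := by positivity
  -- Induction along the previous jump `s`: `log s + log (t / s)` telescopes. The stretch before the
  -- first jump costs the additive `(P + 1) * D`.
  have hjump : ∀ t, 1 ≤ t → t ≤ T → IsJump f S x t →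
      movementCost x t ≤ (P + 1) * D + (P + 1) * A * Real.log t := by
    intro t
    induction t using Nat.strong_induction_on with
    | _ t ih =>
      intro h1 ht hjt
      have ht0 : (0 : ℝ) < t := by exact_mod_cast h1
      rcases exists_last_or_forall_not (IsJump f S x) (t - 1) with h | ⟨s, hs, hst, hjs, h⟩
      · have h2 := hmove 0 t h1 ht h
        have h3 := mul_le_mul_of_nonneg_left (hdist 0 (by omega) t ht) (by positivity : 0 ≤ P + 1)
        have h4 : movementCost x 0 = 0 := by simp [movementCost]
        have h5 : 0 ≤ (P + 1) * A * Real.log t := by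
          have := Real.log_nonneg (show (1 : ℝ) ≤ t by exact_mod_cast h1)
          positivity
        linarith
      · have hst' : s < t := by omega
        have hs0 : (0 : ℝ) < s := by exact_mod_cast hs
        have h2 := ih s hst' hs (by omega) hjs
        have h3 := hmove s t hst' ht h
        have h4 := le_mul_log_div hs0 (show (s : ℝ) ≤ t by exact_mod_cast hst'.le) (by positivity)
          hD0 (hdist s (by omega) t ht) (norm_sub_le_of_isJump hX hG hμ hf hS hs hst' ht hjs hjt h)
        rw [Real.log_div ht0.ne' hs0.ne'] at h4
        have h5 := mul_le_mul_of_nonneg_left h4 (by positivity : 0 ≤ P + 1)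
        rw [← hA] at h5
        linarith
  have hT1 : (1 : ℝ) / 2 ≤ Real.log T := by
    have h1 : (0 : ℝ) < T := by exact_mod_cast (show 0 < T by omega)
    have h2 : (T : ℝ)⁻¹ ≤ 2⁻¹ := inv_anti₀ two_pos (by exact_mod_cast hT)
    linarith [Real.one_sub_inv_le_log_of_pos h1]
  -- The second `(P + 1) * D` pays for the stretch after the last jump; `log T ≥ 1 / 2` then absorbs
  -- both.
  have hfinal : movementCost x T ≤ 2 * ((P + 1) * D) + (P + 1) * A * Real.log T := by
    have hPD : 0 ≤ (P + 1) * D := by positivity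
    rcases exists_last_or_forall_not (IsJump f S x) T with h | ⟨s, hs, hsT, hjs, h⟩
    · have h2 := hmove 0 T (by omega) le_rfl fun τ h1 h2 => h τ h1 (by omega)
      have h3 := mul_le_mul_of_nonneg_left (hdist 0 (by omega) T le_rfl) (by positivity : 0 ≤ P + 1)
      have h4 : movementCost x 0 = 0 := by simp [movementCost]
      have h5 : 0 ≤ (P + 1) * A * Real.log T := by positivity
      linarith
    · have h2 := hjump s hs hsT hjs
      have h3 : Real.log s ≤ Real.log T :=
        Real.log_le_log (by exact_mod_cast hs) (by exact_mod_cast hsT)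
      have h4 := mul_le_mul_of_nonneg_left h3 (by positivity : 0 ≤ (P + 1) * A)
      rcases hsT.eq_or_lt with rfl | hlt
      · linarith
      · have h5 := hmove s T hlt le_rfl fun τ h1 h2 => h τ h1 (by omega)
        have h6 := mul_le_mul_of_nonneg_left (hdist s hsT T le_rfl) (by positivity : 0 ≤ P + 1)
        linarith
  have hPD := mul_le_mul_of_nonneg_left hT1 (by positivity : 0 ≤ 4 * ((P + 1) * D))
  calc movementCost x T ≤ 2 * ((P + 1) * D) + (P + 1) * A * Real.log T := hfinal
    _ ≤ 4 * ((P + 1) * D) * Real.log T + (P + 1) * A * Real.log T := by linarith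
    _ = (P + 1) * (8 * G / μ + 6 * D) * Real.log T := by rw [hA]; ring

end Bounds

/-- From `d = 64 = 8 ^ 2` on, `d ^ (d / 2)` dominates `8 ^ d`; smaller dimensions are absorbed into
`8 ^ 64`. -/
theorem eight_pow_le_mul_rpow (d : ℕ) :
    (8 : ℝ) ^ d ≤ 8 ^ 64 * (d : ℝ) ^ ((d : ℝ) / 2) := by
  rcases Nat.eq_zero_or_pos d with rfl | hd
  · norm_num
  have hd1 : (1 : ℝ) ≤ d := by exact_mod_cast hd
  rcases le_total d 64 with h | h
  · have h1 : (8 : ℝ) ^ d ≤ 8 ^ 64 := pow_le_pow_right₀ (by norm_num) h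
    have h2 : 1 ≤ (d : ℝ) ^ ((d : ℝ) / 2) := Real.one_le_rpow hd1 (by positivity)
    nlinarith
  · have h1 : (8 : ℝ) ^ d = (64 : ℝ) ^ ((d : ℝ) / 2) := by
      rw [show (64 : ℝ) = 8 ^ (2 : ℝ) by norm_num, ← Real.rpow_mul (by norm_num),
        mul_div_cancel₀ _ two_ne_zero, Real.rpow_natCast]
    have h2 : (64 : ℝ) ^ ((d : ℝ) / 2) ≤ (d : ℝ) ^ ((d : ℝ) / 2) :=
      Real.rpow_le_rpow (by norm_num) (by exact_mod_cast h) (by positivity)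
    rw [h1]
    exact h2.trans (le_mul_of_one_le_left (by positivity) (by norm_num))

end CONES

/-- FRUGAL plays feasible actions, has non-positive regret at all times and movement cost
`O(d^{d/2} (2G + (L + μ) D) / μ * log T)` with an absolute constant, where `D` is the diameter of
`X`. -/
theorem mainTheorem1 :
    ∃ C : ℝ, 0 < C ∧
      ∀ (d : ℕ) (X : Set (CONES.E d)) (f : CONES.E d → ℝ) (G L : NNReal) (μ : ℝ)
        (S : ℕ → Set (CONES.E d)) (T : ℕ) (x₀ : CONES.E d),
        IsClosed X → Convex ℝ X → Bornology.IsBounded X →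
        LipschitzOnWith G f X → CONES.SmoothOn f L X → 0 < μ → StrongConvexOn X μ f →
        1 ≤ T → CONES.IsNested X S T → x₀ ∈ X →
        (∀ t, 1 ≤ t → t ≤ T → CONES.frugal f S x₀ t ∈ S t) ∧
        (∀ t, 1 ≤ t → t ≤ T → CONES.regret f S (CONES.frugal f S x₀) t ≤ 0) ∧
        (2 ≤ T → CONES.movementCost (CONES.frugal f S x₀) T ≤
          C * ((d : ℝ) ^ ((d : ℝ) / 2) *
            ((2 * (G : ℝ) + ((L : ℝ) + μ) * Metric.diam X) / μ) * Real.log (T : ℝ))) := by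
  -- `30 = 5 * 6`: the factor `5` comes from `4 * 8 ^ d + 1 ≤ 5 * 8 ^ d`, and `6` from comparing `8
  -- * G / μ + 6 * D` with the stated quotient.
  refine ⟨30 * 8 ^ 64, by positivity, ?_⟩
  intro d X f G L μ S T x₀ _ _ hX hG _ hμ hf _ hS hx₀
  refine ⟨fun t h1 h2 => CONES.frugal_mem hX hG hμ hf hS h1 h2, fun t _ h2 =>
    sub_nonpos.2 (CONES.lossCost_frugal_le hX hG hμ hf hS h2), fun hT => ?_⟩
  refine (CONES.movementCost_frugal_le hX hG hμ hf hS hx₀ hT).trans ?_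
  have hlog : 0 ≤ Real.log (T : ℝ) := Real.log_natCast_nonneg T
  have hD : 0 ≤ Metric.diam X := Metric.diam_nonneg
  have h8 : (4 * 8 ^ d + 1 : ℝ) ≤ 5 * (8 ^ 64 * (d : ℝ) ^ ((d : ℝ) / 2)) := by
    have h1 : (1 : ℝ) ≤ 8 ^ d := one_le_pow₀ (by norm_num)
    linarith [CONES.eight_pow_le_mul_rpow d]
  have hQ : 8 * (G : ℝ) / μ + 6 * Metric.diam X ≤
      6 * ((2 * (G : ℝ) + ((L : ℝ) + μ) * Metric.diam X) / μ) := by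
    have h1 : (2 * (G : ℝ) + ((L : ℝ) + μ) * Metric.diam X) / μ =
        2 * (G / μ) + L * Metric.diam X / μ + Metric.diam X := by
      field_simp
      ring
    have h2 : 0 ≤ (L : ℝ) * Metric.diam X / μ := by positivity
    have h3 : 0 ≤ (G : ℝ) / μ := by positivity
    rw [h1, mul_div_assoc]
    linarith
  calc (4 * 8 ^ d + 1) * (8 * (G : ℝ) / μ + 6 * Metric.diam X) * Real.log (T : ℝ)
      ≤ 5 * (8 ^ 64 * (d : ℝ) ^ ((d : ℝ) / 2)) *
          (6 * ((2 * (G : ℝ) + ((L : ℝ) + μ) * Metric.diam X) / μ)) * Real.log (T : ℝ) := by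
        gcongr
    _ = _ := by ring
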